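/- Let $G=(L\cup R,E)$ be a bipartite graph with known sides $|L|=|R|=n$ and unknown edge set $E\subseteq L\times R$, accessed only through $\mathsf{OR}$-queries: a query is a set $S\subseteq L\times R$, and its answer tells whether $S\cap E\neq\emptyset$. A deterministic $\mathsf{OR}$-query algorithm is, for each $n$, a decision tree over such queries; only queries are counted, not internal computation. A fractional vertex cover of $G$ is a vector $x\in[0,1]^{L\cup R}$ with $x_u+x_v\ge 1$ for every edge $(u,v)\in E$, and its size is $\sum_{v\in L\cup R}x_v$. (1) There are a deterministic $\mathsf{OR}$-query algorithm, correct for every $n\ge 0$, and a constant $C$ such that on every such graph $G$ the algorithm outputs a maximum-cardinality matching $M$ of $G$ together with a fractional vertex cover of $G$ of size strictly less than $|M|+1$ (a witness that $M$ is maximum), and, whenever $n\ge 2$, it makes at most $C\,n\log^2 n$ queries on every such $G$. (2) For an integer $F\ge -1$ let $\mathcal P^G_F$ be the set of all fractional vertex covers of $G$ of size at most $F+\tfrac13$. There are a constant $C$, independent of $n$, $F$ and $G$, and, for every integer $F\ge -1$ given in advance, a deterministic $\mathsf{OR}$-query algorithm, correct for every $n\ge 0$, which on every such graph $G$ either outputs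 a point of $\mathcal P^G_F$, or else outputs a matching of $G$ of size $F+1$, in which case $\mathcal P^G_F=\emptyset$; whenever $n\ge 2$, it makes at most $C\,n\log^2 n$ queries on every such $G$. -/

import Mathlib

namespace ORQuery

/-- The vertex set `L ∪ R` with `|L| = |R| = n`: `Sum.inl i` is the `i`-th left vertex and
`Sum.inr j` the `j`-th right vertex. -/
abbrev Vert (n : ℕ) : Type := Fin n ⊕ Fin n

/-- The pairs in `L × R`, i.e. the potential edges. -/
abbrev Pair (n : ℕ) : Type := Fin n × Fin n

/-- The potential edge `e ∈ L × R` is an edge of `G`. -/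
def IsEdge {n : ℕ} (G : SimpleGraph (Vert n)) (e : Pair n) : Prop :=
  G.Adj (Sum.inl e.1) (Sum.inr e.2)

/-- `G` is bipartite with sides `L` and `R`. -/
def Bip {n : ℕ} (G : SimpleGraph (Vert n)) : Prop :=
  G.IsBipartiteWith (Set.range Sum.inl) (Set.range Sum.inr)

/-- A deterministic `OR`-query algorithm (decision tree) on graphs with `n` vertices on each side,
with outputs in `α`: either stop with an output, or query a set `S ⊆ L × R` of potential edges and
continue according to the one-bit answer. -/
inductive Algorithm (n : ℕ) (α : Type) : Type
  | output (a : α) : Algorithm n α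
  | query (S : Finset (Pair n)) (yes no : Algorithm n α) : Algorithm n α

/-- The positive answer to the `OR`-query `S` on `G`: the set `S` contains at least one edge. -/
def OrAnswer {n : ℕ} (G : SimpleGraph (Vert n)) (S : Finset (Pair n)) : Prop :=
  ∃ e ∈ S, IsEdge G e

open Classical in
/-- The output of the algorithm when run on `G`. -/
noncomputable def Algorithm.result {n : ℕ} {α : Type} (G : SimpleGraph (Vert n)) :
    Algorithm n α → α
  | .output a => a
  | .query S yes no => if OrAnswer G S then yes.result G else no.result G

open Classical in
/-- The number of `OR`-queries that the algorithm makes when run on `G`. -/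
noncomputable def Algorithm.queries {n : ℕ} {α : Type} (G : SimpleGraph (Vert n)) :
    Algorithm n α → ℕ
  | .output _ => 0
  | .query S yes no => 1 + if OrAnswer G S then yes.queries G else no.queries G

/-- `M` is a matching of the bipartite graph `G`: a set of edges, no two of which share a left or
a right endpoint. -/
def IsMatching {n : ℕ} (G : SimpleGraph (Vert n)) (M : Finset (Pair n)) : Prop :=
  (∀ e ∈ M, IsEdge G e) ∧ ∀ e ∈ M, ∀ f ∈ M, e ≠ f → e.1 ≠ f.1 ∧ e.2 ≠ f.2

/-- `M` is a matching of `G` of maximum cardinality. -/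
def IsMaximumMatching {n : ℕ} (G : SimpleGraph (Vert n)) (M : Finset (Pair n)) : Prop :=
  IsMatching G M ∧ ∀ M' : Finset (Pair n), IsMatching G M' → M'.card ≤ M.card

/-- `x` is a fractional vertex cover of `G`. -/
def IsFractionalVertexCover {n : ℕ} (G : SimpleGraph (Vert n)) (x : Vert n → ℝ) : Prop :=
  (∀ v, 0 ≤ x v ∧ x v ≤ 1) ∧ ∀ u v, G.Adj u v → 1 ≤ x u + x v

/-- The polytope of the fractional vertex covers of `G` of size at most `F + 1/3`. -/
def coverPolytope {n : ℕ} (G : SimpleGraph (Vert n)) (F : ℤ) : Set (Vert n → ℝ) :=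
  {x | ∑ v, x v ≤ (F : ℝ) + 1 / 3 ∧ IsFractionalVertexCover G x}

end ORQuery

/-!
The algorithm is a centre of gravity method. Given the edges `E` found so far and a target `g`, let
`K` be the convex body `coverBody E g` of all fractional vertex covers of `E` of size at most
`g - 2 / 3`. Query the set of all pairs `(u, v)` at which the centroid `c` of `K` has
`c u + c v < 1`. If it contains no edge, then `c` is a fractional vertex cover of the whole graph,
and the target is lowered to `g - 1`. Otherwise binary search finds an edge in it with `O(log n)`
further queries, and adding this edge to `E` cuts `K` by a half-space that misses `c`.

Such a cut removes at least a quarter of the volume (`volume_inter_nonneg_le`), whatever the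
dimension. This weak form of Grünbaum's inequality comes from the midpoint inequality
`vol A * vol B ≤ vol ((A + B) / 2) ^ 2` (`volume_mul_volume_le`), proved through the
Prékopa–Leindler inequality by induction on the dimension. It makes the distribution function of an
affine function `Z` on `K` log-concave. If `Z` were negative on less than a quarter of `K`, then the
lower tail of `Z` would decay geometrically on the scale of its median, and the mean of `Z` could
not be negative (`quarter_le_measureReal_neg`).

On the other hand, if `E` has a vertex cover with fewer than `g` vertices, then `K` contains a cube
of side `1 / (12 * (n + 1))` (`le_volume_coverBody`). So once the volume of `K` is below
`(1 / (12 * (n + 1))) ^ (2 * n)`, which takes `O(n log n)` cuts, König's theorem gives a matching of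
size `g` in `E`. The last cover found before has size at most `g + 1 / 3`, hence both outputs are as
required. The target starts at `n` and is lowered at most `n` times while the volume never
increases, so there are `O(n log n)` rounds of `O(log n)` queries each.

The decision version for `F` is read off from this output: with a matching of size `g` and a cover
of size at most `g + 1 / 3`, either `F + 1 ≤ g`, or the cover has size at most `F + 1 / 3`.
-/

namespace ORQuery

open MeasureTheory Set
open scoped ENNReal

/-! ### The Prékopa–Leindler inequality for midpoints -/


theorem volume_preimage_two_mul_sub (A : Set ℝ) (b : ℝ) :
    volume ((fun x : ℝ => 2 * x - b) ⁻¹' A) = 2⁻¹ * volume A := by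
  have h1 : (fun x : ℝ => 2 * x - b) ⁻¹' A =
      (fun x : ℝ => 2 * x) ⁻¹' ((fun x => x + (-b)) ⁻¹' A) := by
    ext x; simp [sub_eq_add_neg]
  rw [h1, Real.volume_preimage_mul_left two_ne_zero, measure_preimage_add_right]
  congr 1
  rw [abs_of_pos (by norm_num), ENNReal.ofReal_inv_of_pos two_pos]
  simp

theorem volume_add_volume_le_of_isCompact {A B C : Set ℝ} (hA : IsCompact A) (hB : IsCompact B)
    (hA0 : A.Nonempty) (hB0 : B.Nonempty) (h : ∀ a ∈ A, ∀ b ∈ B, (a + b) / 2 ∈ C) :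
    volume A + volume B ≤ 2 * volume C := by
  set α := sSup A
  set β := sInf B
  have hα : α ∈ A := hA.sSup_mem hA0
  have hβ : β ∈ B := hB.sInf_mem hB0
  set A' := (fun x : ℝ => 2 * x - β) ⁻¹' A with hA'
  set B' := (fun x : ℝ => 2 * x - α) ⁻¹' B with hB'
  have hm : MeasurableSet B' := (measurable_const.mul measurable_id |>.sub measurable_const)
    hB.measurableSet
  have hunion : A' ∪ B' ⊆ C := by
    rintro x (hx | hx)
    · have := h _ hx _ hβ
      simpa using this
    · have := h _ hα _ hx
      simpa using this
  have hinter : A' ∩ B' ⊆ {(α + β) / 2} := by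
    rintro x ⟨hx, hy⟩
    have h1 : 2 * x - β ≤ α := le_csSup hA.bddAbove hx
    have h2 : β ≤ 2 * x - α := csInf_le hB.bddBelow hy
    have h3 : x = (α + β) / 2 := by linarith
    simp [h3]
  have h0 : volume (A' ∩ B') = 0 := measure_mono_null hinter (by simp)
  have key : 2⁻¹ * volume A + 2⁻¹ * volume B ≤ volume C := by
    rw [← volume_preimage_two_mul_sub A β, ← volume_preimage_two_mul_sub B α,
      ← measure_union_add_inter A' hm, h0, add_zero]
    exact measure_mono hunion
  calc volume A + volume B = 2 * (2⁻¹ * volume A + 2⁻¹ * volume B) := by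
        rw [← mul_add, ← mul_assoc, ENNReal.mul_inv_cancel (by simp) (by simp), one_mul]
    _ ≤ _ := by gcongr

/-- The one-dimensional Brunn–Minkowski inequality, for midpoints. -/
theorem volume_add_volume_le {A B C : Set ℝ} (hA : MeasurableSet A) (hB : MeasurableSet B)
    (hA0 : A.Nonempty) (hB0 : B.Nonempty) (h : ∀ a ∈ A, ∀ b ∈ B, (a + b) / 2 ∈ C) :
    volume A + volume B ≤ 2 * volume C := by
  obtain ⟨a, ha⟩ := hA0
  obtain ⟨b, hb⟩ := hB0
  rw [hA.measure_eq_iSup_isCompact, hB.measure_eq_iSup_isCompact]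
  simp only [iSup_and']
  refine ENNReal.biSup_add_biSup_le' ⟨∅, by simp⟩ ⟨∅, by simp⟩ ?_
  rintro K ⟨hKA, hK⟩ K' ⟨hKB, hK'⟩
  have := volume_add_volume_le_of_isCompact (hK.insert a) (hK'.insert b) (insert_nonempty _ _)
    (insert_nonempty _ _) (C := C) (fun x hx y hy =>
      h x (insert_subset ha hKA hx) y (insert_subset hb hKB hy))
  exact (add_le_add (measure_mono (subset_insert _ _)) (measure_mono (subset_insert _ _))).trans
    this

/-- The layer-cake step: functions with values in `[0, 1]`, where `f` and `g` have supremum `1`. -/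
theorem lintegral_add_lintegral_le_of_sup_eq_one {f g h : ℝ → ℝ} (hf : Measurable f)
    (hg : Measurable g) (hh : Measurable h) (hf0 : ∀ x, 0 ≤ f x) (hg0 : ∀ x, 0 ≤ g x)
    (hh0 : ∀ x, 0 ≤ h x) (hf1 : ∀ x, f x ≤ 1) (hg1 : ∀ x, g x ≤ 1)
    (hfs : ∀ t < 1, ∃ x, t < f x) (hgs : ∀ t < 1, ∃ x, t < g x)
    (hfgh : ∀ x y t, 0 < t → t < f x → t < g y → t < h ((x + y) / 2)) :
    (∫⁻ x, ENNReal.ofReal (f x)) + ∫⁻ x, ENNReal.ofReal (g x)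
      ≤ 2 * ∫⁻ x, ENNReal.ofReal (h x) := by
  rw [lintegral_eq_lintegral_meas_lt _ (.of_forall hf0) hf.aemeasurable,
    lintegral_eq_lintegral_meas_lt _ (.of_forall hg0) hg.aemeasurable,
    lintegral_eq_lintegral_meas_lt _ (.of_forall hh0) hh.aemeasurable]
  have hmeas : ∀ u : ℝ → ℝ, Measurable fun t : ℝ => volume {a : ℝ | t < u a} := fun u =>
    Antitone.measurable fun s t hst => measure_mono fun a (ha : t < u a) => hst.trans_lt ha
  rw [← lintegral_add_left (hmeas f), ← lintegral_const_mul _ (hmeas h)]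
  refine setLIntegral_mono ((hmeas h).const_mul _) fun t ht => ?_
  rcases lt_or_ge t 1 with h1 | h1
  · exact volume_add_volume_le (measurableSet_lt measurable_const hf)
      (measurableSet_lt measurable_const hg) (hfs t h1) (hgs t h1)
      fun a ha b hb => hfgh a b t ht ha hb
  · have e1 : {a | t < f a} = ∅ := by ext a; simpa using (hf1 a).trans h1
    have e2 : {a | t < g a} = ∅ := by ext a; simpa using (hg1 a).trans h1
    simp [e1, e2]

theorem ennreal_mul_le_sq_of_add_le {a b c : ℝ≥0∞} (h : a + b ≤ 2 * c) : a * b ≤ c ^ 2 := by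
  rcases eq_or_ne c ∞ with rfl | hc
  · simp
  have ha : a ≠ ∞ := ne_top_of_le_ne_top (ENNReal.mul_ne_top (by simp) hc) (le_self_add.trans h)
  have hb : b ≠ ∞ := ne_top_of_le_ne_top (ENNReal.mul_ne_top (by simp) hc) (le_add_self.trans h)
  lift a to NNReal using ha
  lift b to NNReal using hb
  lift c to NNReal using hc
  norm_cast at h ⊢
  rw [← NNReal.coe_le_coe] at h ⊢
  push_cast at h ⊢
  nlinarith [sq_nonneg ((a : ℝ) - b), a.2, b.2, c.2]

/-- Bounded functions reduce to functions with supremum `1`, by scaling. -/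
theorem lintegral_mul_lintegral_le_of_bounded {f g h : ℝ → ℝ≥0∞} (hf : Measurable f)
    (hg : Measurable g) (hh : Measurable h) (hfb : ⨆ x, f x ≠ ∞) (hgb : ⨆ x, g x ≠ ∞)
    (hfgh : ∀ x y, f x * g y ≤ h ((x + y) / 2) ^ 2) :
    (∫⁻ x, f x) * ∫⁻ x, g x ≤ (∫⁻ x, h x) ^ 2 := by
  rcases eq_or_ne (⨆ x, f x) 0 with hf0 | hf0
  · have : ∀ x, f x = 0 := fun x => le_antisymm (hf0 ▸ le_iSup f x) bot_le
    simp [this]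
  rcases eq_or_ne (⨆ x, g x) 0 with hg0 | hg0
  · have : ∀ x, g x = 0 := fun x => le_antisymm (hg0 ▸ le_iSup g x) bot_le
    simp [this]
  obtain ⟨α, hα⟩ : ∃ α : ℝ≥0∞, α = ⨆ x, f x := ⟨_, rfl⟩
  obtain ⟨β, hβ⟩ : ∃ β : ℝ≥0∞, β = ⨆ x, g x := ⟨_, rfl⟩
  rw [← hα] at hf0 hfb
  rw [← hβ] at hg0 hgb
  -- `h` is scaled by the geometric mean `γ` of the two suprema, which preserves the hypothesis
  obtain ⟨γ, hγ⟩ : ∃ γ : ℝ≥0∞, γ ^ 2 = α * β :=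
    ⟨(α * β) ^ (2⁻¹ : ℝ), by rw [← ENNReal.rpow_natCast, ← ENNReal.rpow_mul]; simp⟩
  have hγ0 : γ ≠ 0 := by rintro rfl; simp [hf0, hg0] at hγ
  have hγt : γ ≠ ∞ := by
    rintro rfl
    exact ENNReal.mul_ne_top hfb hgb (by rw [← hγ]; simp)
  have hfα : ∀ x, f x / α ≤ 1 := fun x => ENNReal.div_le_of_le_mul (by
    rw [one_mul, hα]; exact le_iSup f x)
  have hgβ : ∀ x, g x / β ≤ 1 := fun x => ENNReal.div_le_of_le_mul (by
    rw [one_mul, hβ]; exact le_iSup g x)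
  have sup_one : ∀ {u : ℝ → ℝ≥0∞} {a : ℝ≥0∞}, a = ⨆ x, u x → a ≠ 0 → a ≠ ∞ →
      (∀ x, u x / a ≤ 1) → ∀ t < (1 : ℝ), ∃ x, t < (u x / a).toReal := by
    intro u a ha ha0 hat hle t ht
    have h1 : ENNReal.ofReal t * a < ⨆ x, u x := by
      rw [← ha]
      calc ENNReal.ofReal t * a < 1 * a :=
            ENNReal.mul_lt_mul_left ha0 hat (by simpa using ht)
        _ = a := one_mul a
    obtain ⟨x, hx⟩ := lt_iSup_iff.1 h1
    refine ⟨x, ?_⟩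
    by_contra! hcon
    refine absurd (ENNReal.ofReal_le_ofReal hcon) (not_le.2 ?_)
    rw [ENNReal.ofReal_toReal (ne_top_of_le_ne_top ENNReal.one_ne_top (hle x))]
    exact (ENNReal.lt_div_iff_mul_lt (.inl ha0) (.inl hat)).2 hx
  have key := lintegral_add_lintegral_le_of_sup_eq_one
    (f := fun x => (f x / α).toReal) (g := fun x => (g x / β).toReal)
    (h := fun x => (min (h x / γ) 1).toReal)
    (hf.div_const α).ennreal_toReal (hg.div_const β).ennreal_toReal
    ((hh.div_const γ).min measurable_const).ennreal_toReal
    (fun _ => ENNReal.toReal_nonneg) (fun _ => ENNReal.toReal_nonneg)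
    (fun _ => ENNReal.toReal_nonneg)
    (fun x => ENNReal.toReal_le_of_le_ofReal zero_le_one (by simpa using hfα x))
    (fun x => ENNReal.toReal_le_of_le_ofReal zero_le_one (by simpa using hgβ x))
    (sup_one hα hf0 hfb hfα) (sup_one hβ hg0 hgb hgβ) ?_
  · have fin : ∀ {u : ℝ≥0∞}, u ≤ 1 → ENNReal.ofReal u.toReal = u := fun hu =>
      ENNReal.ofReal_toReal (ne_top_of_le_ne_top ENNReal.one_ne_top hu)
    simp only [fin (hfα _), fin (hgβ _), fin (min_le_right _ _)] at key
    have key2 : (∫⁻ x, f x / α) + ∫⁻ x, g x / β ≤ 2 * ∫⁻ x, h x / γ :=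
      key.trans (by gcongr; exact min_le_left _ _)
    have key3 := ennreal_mul_le_sq_of_add_le key2
    simp only [div_eq_mul_inv] at key3
    rw [lintegral_mul_const _ hf, lintegral_mul_const _ hg, lintegral_mul_const _ hh] at key3
    calc (∫⁻ x, f x) * ∫⁻ x, g x
        = ((∫⁻ x, f x) * α⁻¹ * ((∫⁻ x, g x) * β⁻¹)) * (α * β) := by
          rw [show ((∫⁻ x, f x) * α⁻¹ * ((∫⁻ x, g x) * β⁻¹)) * (α * β)
            = (∫⁻ x, f x) * (∫⁻ x, g x) * (α * α⁻¹) * (β * β⁻¹) by ring,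
            ENNReal.mul_inv_cancel hf0 hfb, ENNReal.mul_inv_cancel hg0 hgb, mul_one, mul_one]
      _ ≤ ((∫⁻ x, h x) * γ⁻¹) ^ 2 * (α * β) := by gcongr
      _ = (∫⁻ x, h x) ^ 2 * (γ * γ⁻¹) ^ 2 := by rw [← hγ]; ring
      _ = (∫⁻ x, h x) ^ 2 := by rw [ENNReal.mul_inv_cancel hγ0 hγt]; ring
  · intro x y t ht hx hy
    have ht1 : ENNReal.ofReal t < 1 := by
      have := hx.trans_le (ENNReal.toReal_le_of_le_ofReal zero_le_one (by simpa using hfα x))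
      simpa using this
    rw [← ENNReal.ofReal_lt_iff_lt_toReal ht.le
      (ne_top_of_le_ne_top ENNReal.one_ne_top (hfα x))] at hx
    rw [← ENNReal.ofReal_lt_iff_lt_toReal ht.le
      (ne_top_of_le_ne_top ENNReal.one_ne_top (hgβ y))] at hy
    rw [← ENNReal.ofReal_lt_iff_lt_toReal ht.le
      (ne_top_of_le_ne_top ENNReal.one_ne_top (min_le_right _ _)), lt_min_iff]
    refine ⟨?_, ht1⟩
    by_contra! hcon
    have h1 : ENNReal.ofReal t * ENNReal.ofReal t < f x / α * (g y / β) := ENNReal.mul_lt_mul hx hy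
    have h2 : f x / α * (g y / β) ≤ (h ((x + y) / 2) / γ) ^ 2 := by
      have e1 : f x / α * (g y / β) = f x * g y * (α * β)⁻¹ := by
        rw [ENNReal.mul_inv (.inl hf0) (.inl hfb)]; simp only [div_eq_mul_inv]; ring
      rw [e1, ← hγ, ENNReal.inv_pow, div_eq_mul_inv, mul_pow]
      gcongr
      exact hfgh x y
    have h3 : (h ((x + y) / 2) / γ) ^ 2 ≤ ENNReal.ofReal t ^ 2 := by gcongr
    exact absurd (h1.trans_le (h2.trans h3)) (by rw [sq]; exact lt_irrefl _)

/-- The Prékopa–Leindler inequality on the line, for midpoints. -/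
theorem lintegral_mul_lintegral_le_real {f g h : ℝ → ℝ≥0∞} (hf : Measurable f)
    (hg : Measurable g) (hh : Measurable h)
    (hfgh : ∀ x y, f x * g y ≤ h ((x + y) / 2) ^ 2) :
    (∫⁻ x, f x) * ∫⁻ x, g x ≤ (∫⁻ x, h x) ^ 2 := by
  have trunc : ∀ {u : ℝ → ℝ≥0∞}, Measurable u →
      ∫⁻ x, u x = ⨆ N : ℕ, ∫⁻ x, min (u x) N := by
    intro u hu
    rw [← lintegral_iSup (fun N => hu.min measurable_const)
      (fun M N hMN x => min_le_min_left _ (by exact_mod_cast hMN))]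
    congr 1 with x
    rw [← inf_iSup_eq, ENNReal.iSup_natCast, inf_top_eq]
  have bdd : ∀ (u : ℝ → ℝ≥0∞) (N : ℕ), ⨆ x, min (u x) (N : ℝ≥0∞) ≠ ∞ := fun u N =>
    ne_top_of_le_ne_top (ENNReal.natCast_ne_top N) (iSup_le fun x => min_le_right _ _)
  rw [trunc hf, trunc hg]
  rw [ENNReal.iSup_mul]
  refine iSup_le fun M => ?_
  rw [ENNReal.mul_iSup]
  refine iSup_le fun N => ?_
  exact lintegral_mul_lintegral_le_of_bounded (hf.min measurable_const) (hg.min measurable_const)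
    hh (bdd f M) (bdd g N) fun x y => (mul_le_mul' (min_le_left _ _) (min_le_left _ _)).trans
      (hfgh x y)

theorem piFinSuccAbove_zero_symm_apply {d : ℕ} (p : ℝ × (Fin d → ℝ)) :
    (MeasurableEquiv.piFinSuccAbove (fun _ : Fin (d + 1) => ℝ) 0).symm p = Fin.cons p.1 p.2 := by
  simp [MeasurableEquiv.piFinSuccAbove_symm_apply, Fin.insertNthEquiv]

theorem lintegral_fin_succ {d : ℕ} {f : (Fin (d + 1) → ℝ) → ℝ≥0∞} (hf : Measurable f) :
    ∫⁻ x, f x = ∫⁻ a : ℝ, ∫⁻ x : Fin d → ℝ, f (Fin.cons a x) := by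
  have e := (volume_preserving_piFinSuccAbove (fun _ : Fin (d + 1) => ℝ) 0).symm
  rw [← e.lintegral_comp hf, Measure.volume_eq_prod, lintegral_prod]
  · simp only [piFinSuccAbove_zero_symm_apply]
  · exact (hf.comp (MeasurableEquiv.measurable _)).aemeasurable

/-- The Prékopa–Leindler inequality for midpoints, by induction on the dimension. -/
theorem lintegral_mul_lintegral_le_fin {d : ℕ} {f g h : (Fin d → ℝ) → ℝ≥0∞} (hf : Measurable f)
    (hg : Measurable g) (hh : Measurable h)
    (hfgh : ∀ x y, f x * g y ≤ h ((2⁻¹ : ℝ) • (x + y)) ^ 2) :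
    (∫⁻ x, f x) * ∫⁻ x, g x ≤ (∫⁻ x, h x) ^ 2 := by
  induction d with
  | zero =>
    have : (volume : Measure (Fin 0 → ℝ)) = Measure.dirac default := by
      rw [volume_pi, Measure.pi_of_empty _ default]
    simp only [this, lintegral_dirac]
    convert hfgh default default
  | succ d ih =>
    rw [lintegral_fin_succ hf, lintegral_fin_succ hg, lintegral_fin_succ hh]
    have hcons : Measurable fun p : ℝ × (Fin d → ℝ) => (Fin.cons p.1 p.2 : Fin (d + 1) → ℝ) := by
      simpa only [← piFinSuccAbove_zero_symm_apply] using
        (MeasurableEquiv.piFinSuccAbove (fun _ : Fin (d + 1) => ℝ) 0).symm.measurable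
    have m : ∀ {u : (Fin (d + 1) → ℝ) → ℝ≥0∞}, Measurable u →
        Measurable fun a : ℝ => ∫⁻ x : Fin d → ℝ, u (Fin.cons a x) := fun hu =>
      Measurable.lintegral_prod_right' (hu.comp hcons)
    have s : ∀ {u : (Fin (d + 1) → ℝ) → ℝ≥0∞}, Measurable u → ∀ a : ℝ,
        Measurable fun x : Fin d → ℝ => u (Fin.cons a x) := fun hu a =>
      (hu.comp hcons).comp measurable_prodMk_left
    refine lintegral_mul_lintegral_le_real (m hf) (m hg) (m hh) fun a b =>
      ih (s hf a) (s hg b) (s hh _) fun x y => ?_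
    convert hfgh (Fin.cons a x) (Fin.cons b y) using 3
    ext i
    refine Fin.cases ?_ (fun j => ?_) i
    · simp; ring
    · simp; ring

/-- The multiplicative Brunn–Minkowski inequality for midpoints. -/
theorem volume_mul_volume_le {ι : Type*} [Fintype ι] {A B C : Set (ι → ℝ)}
    (hA : MeasurableSet A) (hB : MeasurableSet B) (hC : MeasurableSet C)
    (h : ∀ x ∈ A, ∀ y ∈ B, (2⁻¹ : ℝ) • (x + y) ∈ C) :
    volume A * volume B ≤ volume C ^ 2 := by
  have e := volume_measurePreserving_piCongrLeft (fun _ : ι => ℝ) (Fintype.equivFin ι).symm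
  set φ := MeasurableEquiv.piCongrLeft (fun _ : ι => ℝ) (Fintype.equivFin ι).symm
  have hφ : ∀ (x : Fin (Fintype.card ι) → ℝ) i, φ x i = x (Fintype.equivFin ι i) := by
    intro x i
    have := MeasurableEquiv.piCongrLeft_apply_apply (β := fun _ : ι => ℝ)
      (Fintype.equivFin ι).symm x
      (Fintype.equivFin ι i)
    simpa using this
  have hφ2 : ∀ x y, φ ((2⁻¹ : ℝ) • (x + y)) = (2⁻¹ : ℝ) • (φ x + φ y) := by
    intro x y; ext i; simp [hφ]; ring
  rw [← e.measure_preimage hA.nullMeasurableSet, ← e.measure_preimage hB.nullMeasurableSet,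
    ← e.measure_preimage hC.nullMeasurableSet]
  have hA' := φ.measurable hA
  have hB' := φ.measurable hB
  have hC' := φ.measurable hC
  rw [← lintegral_indicator_one hA', ← lintegral_indicator_one hB', ← lintegral_indicator_one hC']
  refine lintegral_mul_lintegral_le_fin (measurable_one.indicator hA') (measurable_one.indicator hB')
    (measurable_one.indicator hC') fun x y => ?_
  by_cases hx : x ∈ φ ⁻¹' A
  · by_cases hy : y ∈ φ ⁻¹' B
    · have : (2⁻¹ : ℝ) • (x + y) ∈ φ ⁻¹' C := by
        rw [mem_preimage, hφ2]; exact h _ hx _ hy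
      simp only [indicator_of_mem hx, indicator_of_mem hy, indicator_of_mem this]
      simp
    · simp [indicator_of_notMem hy]
  · simp [indicator_of_notMem hx]

/-! ### Cuts through the centroid -/

/-- Discretization of the negative part of `z` with step `s`. -/
theorem min_neg_le_sum_indicator (s z : ℝ) (N : ℕ) :
    min (-z) (N * s) ≤ s * ∑ j ∈ Finset.range N, if z < -(j * s) then (1 : ℝ) else 0 := by
  induction N with
  | zero => simp
  | succ N ih =>
    rw [Finset.sum_range_succ, mul_add]
    push_cast
    by_cases hz : z < -(N * s)
    · rw [if_pos hz]
      rw [min_eq_right (by linarith)] at ih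
      calc _ ≤ (N + 1) * s := min_le_right _ _
        _ ≤ _ := by linarith
    · rw [if_neg hz]
      rw [min_eq_left (by linarith)] at ih
      calc _ ≤ -z := min_le_left _ _
        _ ≤ _ := by linarith

/-- A log-concave distribution function decays geometrically below a point where it is small
compared to its value at a later point. -/
theorem le_half_pow_of_logConcave {G : ℝ → ℝ} (hG0 : ∀ s, 0 ≤ G s) (hmono : Monotone G)
    (hG : ∀ s t, G s * G t ≤ G ((s + t) / 2) ^ 2) {s : ℝ} (hs : 0 ≤ s) (h : 2 * G 0 ≤ G s)
    (j : ℕ) : G (-(j * s)) ≤ G 0 * (1 / 2) ^ j := by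
  have ratio : ∀ j : ℕ, G (-((j + 1 : ℕ) * s)) ≤ G (-(j * s)) / 2 := by
    intro j
    induction j with
    | zero =>
      have h1 := hG (-s) s
      have h2 : (-s + s) / 2 = 0 := by ring
      rw [h2] at h1
      simp only [Nat.cast_zero, zero_mul, neg_zero, zero_add, Nat.cast_one, one_mul]
      rcases (hG0 0).eq_or_lt with h3 | h3
      · rw [← h3, zero_div, h3]; exact hmono (by linarith)
      · have := hG0 (-s)
        have h4 : G (-s) * (2 * G 0) ≤ G 0 ^ 2 := (mul_le_mul_of_nonneg_left h this).trans h1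
        nlinarith
    | succ j ih =>
      have h1 := hG (-((j + 1 + 1 : ℕ) * s)) (-(j * s))
      have h2 : (-((j + 1 + 1 : ℕ) * s) + -(j * s)) / 2 = -((j + 1 : ℕ) * s) := by
        push_cast; ring
      rw [h2] at h1
      rcases (hG0 (-(j * s))).eq_or_lt with h3 | h3
      · have h4 : G (-((j + 1 + 1 : ℕ) * s)) ≤ G (-(j * s)) :=
          hmono (by push_cast; nlinarith)
        have := hG0 (-((j + 1 : ℕ) * s))
        linarith
      · have := hG0 (-((j + 1 : ℕ) * s))
        by_contra! hcon
        nlinarith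
  induction j with
  | zero => simp
  | succ j ih =>
    refine (ratio j).trans ?_
    rw [pow_succ]
    linarith

/-- If the distribution function of `Z` is midpoint log-concave and the mean of `Z` is negative,
then `Z` is negative on at least a quarter of the space. -/
theorem quarter_le_measureReal_neg {Ω : Type*} [MeasurableSpace Ω] {μ : Measure Ω}
    [IsFiniteMeasure μ] {Z : Ω → ℝ} (hZ : Measurable Z) {B : ℝ} (hB : ∀ ω, |Z ω| ≤ B)
    (hG : ∀ s t, μ.real {ω | Z ω < s} * μ.real {ω | Z ω < t} ≤
      μ.real {ω | Z ω < (s + t) / 2} ^ 2)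
    (hmean : ∫ ω, Z ω ∂μ < 0) : μ.real univ / 4 ≤ μ.real {ω | Z ω < 0} := by
  by_contra! hp
  set m := μ.real univ with hm
  set G : ℝ → ℝ := fun s => μ.real {ω | Z ω < s} with hGdef
  have hG0 : ∀ s, 0 ≤ G s := fun s => measureReal_nonneg
  have hmono : Monotone G := fun s t hst =>
    measureReal_mono (fun ω (h : Z ω < s) => h.trans_le hst)
  change G 0 < m / 4 at hp
  have hmpos : 0 < m := by linarith [hG0 0]
  have hmeas : ∀ s, MeasurableSet {ω | Z ω < s} := fun s => measurableSet_lt hZ measurable_const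
  have hZint : Integrable Z μ :=
    Integrable.of_bound hZ.aestronglyMeasurable B (.of_forall hB)
  -- The mean is bounded below by comparing two levels `s < s'` around the median.
  have key : ∀ s s', 0 ≤ s → 0 < s' → G s ≤ m / 2 → m / 2 < G s' →
      (s - s') * (m / 2) ≤ ∫ ω, Z ω ∂μ := by
    intro s s' hs hs' h1 h2
    obtain ⟨N, hN⟩ := exists_nat_ge (B / s')
    have hN' : B ≤ N * s' := by rwa [div_le_iff₀ hs'] at hN
    set U : Ω → ℝ := fun ω => s * (1 - {ω | Z ω < s}.indicator 1 ω) -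
      s' * ∑ j ∈ Finset.range N, {ω | Z ω < -(j * s')}.indicator 1 ω with hU
    have hind : ∀ t, Integrable ({ω | Z ω < t}.indicator (1 : Ω → ℝ)) μ := fun t =>
      (integrable_const (1 : ℝ)).indicator (hmeas t)
    have hUint1 : Integrable (fun ω => s * (1 - {ω | Z ω < s}.indicator (1 : Ω → ℝ) ω)) μ :=
      ((integrable_const 1).sub (hind s)).const_mul s
    have hUint2 : Integrable (fun ω => s' * ∑ j ∈ Finset.range N,
        {ω | Z ω < -(j * s')}.indicator (1 : Ω → ℝ) ω) μ :=
      (integrable_finsetSum _ fun j _ => hind _).const_mul s'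
    have hUle : ∀ ω, U ω ≤ Z ω := by
      intro ω
      have h3 := min_neg_le_sum_indicator s' (Z ω) N
      simp only [hU, indicator_apply, mem_ofPred_eq, Pi.one_apply]
      rcases lt_or_ge (Z ω) 0 with h4 | h4
      · rw [min_eq_left ((neg_le_abs _).trans ((hB ω).trans hN'))] at h3
        rw [if_pos (by linarith)]
        linarith
      · have h5 : ∀ j ∈ Finset.range N, (if Z ω < -(j * s') then (1 : ℝ) else 0) = 0 := by
          intro j _
          have : 0 ≤ j * s' := by positivity
          rw [if_neg (by linarith)]
        rw [Finset.sum_eq_zero h5]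
        split_ifs <;> linarith
    have hUeq : ∫ ω, U ω ∂μ = s * (m - G s) - s' * ∑ j ∈ Finset.range N, G (-(j * s')) := by
      simp only [hU]
      rw [integral_sub hUint1 hUint2, integral_const_mul, integral_const_mul,
        integral_sub (integrable_const 1) (hind s), integral_finsetSum _ fun j _ => hind _]
      simp [integral_indicator_one, hmeas, hGdef, hm]
    have hsum : ∑ j ∈ Finset.range N, G (-(j * s')) ≤ m / 2 := by
      calc ∑ j ∈ Finset.range N, G (-(j * s'))
          ≤ ∑ j ∈ Finset.range N, G 0 * (1 / 2) ^ j := Finset.sum_le_sum fun j _ =>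
            le_half_pow_of_logConcave hG0 hmono hG hs'.le (by linarith) j
        _ = G 0 * ∑ j ∈ Finset.range N, (1 / 2 : ℝ) ^ j := by rw [Finset.mul_sum]
        _ ≤ G 0 * 2 := mul_le_mul_of_nonneg_left (sum_geometric_two_le N) (hG0 0)
        _ ≤ m / 2 := by linarith
    calc (s - s') * (m / 2) ≤ s * (m - G s) - s' * ∑ j ∈ Finset.range N, G (-(j * s')) := by
          nlinarith
      _ = ∫ ω, U ω ∂μ := hUeq.symm
      _ ≤ ∫ ω, Z ω ∂μ := integral_mono (hUint1.sub hUint2) hZint hUle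
  -- `M` is the median.
  set S := {s | G s ≤ m / 2}
  have h0S : (0 : ℝ) ∈ S := by change G 0 ≤ m / 2; linarith
  have hbdd : BddAbove S := by
    refine ⟨B + 1, fun s (hs : G s ≤ m / 2) => ?_⟩
    by_contra! hlt
    have : G s = m := by
      simp only [hGdef, hm]
      congr 1
      ext ω
      simpa using ((le_abs_self _).trans (hB ω)).trans_lt (by linarith)
    linarith
  set M := sSup S
  have hM0 : 0 ≤ M := le_csSup hbdd h0S
  set ε := -(∫ ω, Z ω ∂μ) / (2 * m) with hε
  have hεpos : 0 < ε := div_pos (by linarith) (by linarith)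
  have hεm : ε * m = -(∫ ω, Z ω ∂μ) / 2 := by rw [hε]; field_simp
  obtain ⟨s, hsS, hs⟩ := exists_lt_of_lt_csSup ⟨0, h0S⟩ (show M - ε < M by linarith)
  have h1 : G (max s 0) ≤ m / 2 := by
    rcases max_choice s 0 with h | h <;> rw [h]
    exacts [hsS, h0S]
  have h2 : m / 2 < G (M + ε) := by
    by_contra! hcon
    linarith [le_csSup hbdd hcon]
  have h3 := key (max s 0) (M + ε) (le_max_right _ _) (by linarith) h1 h2
  nlinarith [le_max_left s 0]

/-- A weak form of Grünbaum's inequality, with `1 / 4` in place of `1 / e`: the part of a convex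
body where an affine function is nonnegative has at most three quarters of the volume, if the
function has negative mean. -/
theorem volume_inter_nonneg_le {ι : Type*} [Fintype ι] {K : Set (ι → ℝ)} (hK : Convex ℝ K)
    (hKm : MeasurableSet K) (hKfin : volume K ≠ ∞) {Z : (ι → ℝ) → ℝ} (hZ : Measurable Z)
    (hZmid : ∀ x y, Z ((2⁻¹ : ℝ) • (x + y)) = (Z x + Z y) / 2) {B : ℝ}
    (hB : ∀ x ∈ K, |Z x| ≤ B) (hmean : ∫ x in K, Z x < 0) :
    volume.real (K ∩ {x | 0 ≤ Z x}) ≤ 3 / 4 * volume.real K := by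
  have hmeas : ∀ s, MeasurableSet {x | Z x < s} := fun s => measurableSet_lt hZ measurable_const
  -- truncating `Z` makes it bounded everywhere and does not change it on `K`
  set Z' : (ι → ℝ) → ℝ := K.indicator Z
  have hZ'm : Measurable Z' := hZ.indicator hKm
  have hZ'b : ∀ x, |Z' x| ≤ max B 0 := by
    intro x
    by_cases hx : x ∈ K
    · simp only [Z', indicator_of_mem hx]; exact (hB x hx).trans (le_max_left _ _)
    · simp [Z', indicator_of_notMem hx]
  have hset : ∀ s, {x | Z' x < s} ∩ K = {x | Z x < s} ∩ K := by
    intro s; ext x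
    simp only [mem_inter_iff, mem_ofPred_eq, and_congr_left_iff]
    intro hx
    simp [Z', indicator_of_mem hx]
  have hreal : ∀ s, (volume.restrict K).real {x | Z' x < s} = volume.real ({x | Z x < s} ∩ K) := by
    intro s
    rw [measureReal_restrict_apply (measurableSet_lt hZ'm measurable_const), hset]
  have : IsFiniteMeasure (volume.restrict K) := ⟨by simpa using hKfin.lt_top⟩
  have hq := quarter_le_measureReal_neg (μ := volume.restrict K) hZ'm hZ'b (fun s t => by
    simp only [hreal, measureReal_def]
    rw [← ENNReal.toReal_mul, ← ENNReal.toReal_pow]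
    refine ENNReal.toReal_mono (ENNReal.pow_ne_top
      (measure_ne_top_of_subset inter_subset_right hKfin)) ?_
    refine volume_mul_volume_le ((hmeas _).inter hKm) ((hmeas _).inter hKm)
      ((hmeas _).inter hKm) ?_
    rintro x ⟨hx, hxK⟩ y ⟨hy, hyK⟩
    refine ⟨?_, ?_⟩
    · simp only [mem_ofPred_eq] at hx hy ⊢
      rw [hZmid]
      linarith
    · rw [smul_add]
      exact hK hxK hyK (by norm_num) (by norm_num) (by norm_num)) (by
    rwa [setIntegral_congr_fun hKm fun x hx => indicator_of_mem hx Z])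
  rw [hreal, measureReal_restrict_apply MeasurableSet.univ, univ_inter] at hq
  have hsplit := measureReal_inter_add_sdiff₀ (μ := volume) (s := K) (t := {x | Z x < 0})
    (hmeas 0).nullMeasurableSet hKfin
  have hdiff : K \ {x | Z x < 0} = K ∩ {x | 0 ≤ Z x} := by
    ext x; simp
  rw [hdiff, inter_comm] at hsplit
  linarith

/-! ### König's theorem -/

/-- König's theorem: a bipartite edge set all of whose vertex covers have at least `g` vertices
contains a matching of size `g`. -/
theorem exists_matching_of_le_cover {n : ℕ} (E : Finset (Pair n)) (g : ℕ)
    (hcov : ∀ A B : Finset (Fin n), (∀ e ∈ E, e.1 ∈ A ∨ e.2 ∈ B) → g ≤ A.card + B.card) :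
    ∃ M ⊆ E, (∀ e ∈ M, ∀ f ∈ M, e ≠ f → e.1 ≠ f.1 ∧ e.2 ≠ f.2) ∧ M.card = g := by
  classical
  have hgn : g ≤ n := by
    -- all left vertices form a cover
    simpa using hcov Finset.univ ∅ (by simp)
  -- Hall's theorem, after adding `n - g` vertices on the right that are joined to everything.
  set N : Fin n → Finset (Fin n) := fun u => Finset.univ.filter fun v => (u, v) ∈ E with hN
  set t : Fin n → Finset (Fin n ⊕ Fin (n - g)) := fun u => (N u).disjSum Finset.univ with ht
  have hall : ∀ S : Finset (Fin n), S.card ≤ (S.biUnion t).card := by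
    intro S
    rcases S.eq_empty_or_nonempty with rfl | hS
    · simp
    have h1 := hcov Sᶜ (S.biUnion N) (by
      rintro ⟨u, v⟩ he
      by_cases hu : u ∈ S
      · right
        simp only [Finset.mem_biUnion, hN, Finset.mem_filter, Finset.mem_univ, true_and]
        exact ⟨u, hu, he⟩
      · left; simpa using hu)
    rw [Finset.card_compl, Fintype.card_fin] at h1
    have h2 : (S.biUnion t) = (S.biUnion N).disjSum Finset.univ := by
      ext (a | a)
      · simp [ht]
      · simpa [ht] using (show ∃ a, a ∈ S from hS)
    rw [h2, Finset.card_disjSum, Finset.card_univ, Fintype.card_fin]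
    have := Finset.card_le_univ S
    rw [Fintype.card_fin] at this
    omega
  obtain ⟨f, hfinj, hf⟩ := (Finset.all_card_le_biUnion_card_iff_exists_injective t).1 hall
  set M : Finset (Pair n) := Finset.univ.filter fun e => f e.1 = Sum.inl e.2 with hM
  have hMmem : ∀ e, e ∈ M ↔ f e.1 = Sum.inl e.2 := by simp [hM]
  have hME : M ⊆ E := by
    rintro ⟨u, v⟩ he
    rw [hMmem] at he
    have := hf u
    rw [he] at this
    simpa [ht, hN] using this
  have hmat : ∀ e ∈ M, ∀ f ∈ M, e ≠ f → e.1 ≠ f.1 ∧ e.2 ≠ f.2 := by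
    rintro ⟨u, v⟩ he ⟨u', v'⟩ he' hne
    rw [hMmem] at he he'
    simp only at he he'
    constructor
    · rintro rfl
      rw [he] at he'
      exact hne (by rw [Sum.inl_injective he'])
    · rintro rfl
      exact hne (by rw [hfinj (he.trans he'.symm)])
  have hcard : g ≤ M.card := by
    have h1 : (Finset.univ.image f) ⊆ (M.image Prod.snd).disjSum Finset.univ := by
      intro a ha
      obtain ⟨u, -, rfl⟩ := Finset.mem_image.1 ha
      rcases hu : f u with v | d
      · simp only [Finset.inl_mem_disjSum, Finset.mem_image]
        exact ⟨(u, v), (hMmem _).2 hu, rfl⟩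
      · simp
    have h2 := Finset.card_le_card h1
    rw [Finset.card_image_of_injective _ hfinj, Finset.card_disjSum, Finset.card_univ,
      Finset.card_univ, Fintype.card_fin, Fintype.card_fin] at h2
    have h3 : (M.image Prod.snd).card ≤ M.card := Finset.card_image_le
    omega
  obtain ⟨M', hM', hc⟩ := Finset.exists_subset_card_eq hcard
  exact ⟨M', hM'.trans hME, fun e he f hf => hmat e (hM' he) f (hM' hf), hc⟩

/-! ### The body of candidate fractional covers -/

/-- The fractional vertex covers of the edge set `E` of size at most `g - 2 / 3`. It contains
a small cube if fewer than `g` vertices cover `E`, and it is empty if `E` contains a matching of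
size `g`. -/
def coverBody {n : ℕ} (E : Finset (Pair n)) (g : ℕ) : Set (Vert n → ℝ) :=
  {x | (∀ v, 0 ≤ x v ∧ x v ≤ 1) ∧ (∀ e ∈ E, 1 ≤ x (Sum.inl e.1) + x (Sum.inr e.2)) ∧
    ∑ v, x v + 2 / 3 ≤ g}

section coverBody

variable {n : ℕ} (E : Finset (Pair n)) (g : ℕ)

theorem convex_coverBody : Convex ℝ (coverBody E g) := by
  rintro x ⟨hx1, hx2, hx3⟩ y ⟨hy1, hy2, hy3⟩ a b ha hb hab
  refine ⟨fun v => ?_, fun e he => ?_, ?_⟩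
  · obtain ⟨h1, h2⟩ := hx1 v
    obtain ⟨h3, h4⟩ := hy1 v
    simp only [Pi.add_apply, Pi.smul_apply, smul_eq_mul]
    exact ⟨by positivity, by nlinarith⟩
  · have h1 := hx2 e he
    have h2 := hy2 e he
    simp only [Pi.add_apply, Pi.smul_apply, smul_eq_mul]
    nlinarith
  · simp only [Pi.add_apply, Pi.smul_apply, smul_eq_mul, Finset.sum_add_distrib, ← Finset.mul_sum]
    nlinarith

theorem isClosed_coverBody : IsClosed (coverBody E g) := by
  have h : coverBody E g = (⋂ v, {x | 0 ≤ x v} ∩ {x | x v ≤ 1}) ∩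
      ((⋂ e ∈ E, {x | 1 ≤ x (Sum.inl e.1) + x (Sum.inr e.2)}) ∩
        {x : Vert n → ℝ | ∑ v, x v + 2 / 3 ≤ (g : ℝ)}) := by
    ext x
    simp only [coverBody, mem_ofPred_eq, mem_inter_iff, mem_iInter]
  rw [h]
  refine (isClosed_iInter fun v => ?_).inter (IsClosed.inter ?_ ?_)
  · exact (isClosed_le (by fun_prop) (by fun_prop)).inter (isClosed_le (by fun_prop) (by fun_prop))
  · exact isClosed_biInter fun e _ => isClosed_le (by fun_prop) (by fun_prop)
  · exact isClosed_le (by fun_prop) (by fun_prop)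

theorem coverBody_subset_Icc : coverBody E g ⊆ Icc 0 1 :=
  fun _ hx => ⟨fun v => (hx.1 v).1, fun v => (hx.1 v).2⟩

theorem volume_coverBody_le_one : volume (coverBody E g) ≤ 1 := by
  refine (measure_mono (coverBody_subset_Icc E g)).trans ?_
  simp [Real.volume_Icc_pi]

theorem volume_coverBody_ne_top : volume (coverBody E g) ≠ ∞ :=
  ne_top_of_le_ne_top ENNReal.one_ne_top (volume_coverBody_le_one E g)

theorem coverBody_mono {E E' : Finset (Pair n)} {g g' : ℕ} (hE : E ⊆ E') (hg : g' ≤ g) :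
    coverBody E' g' ⊆ coverBody E g :=
  fun _ hx => ⟨hx.1, fun e he => hx.2.1 e (hE he), hx.2.2.trans (by exact_mod_cast hg)⟩

theorem isCompact_coverBody : IsCompact (coverBody E g) :=
  isCompact_Icc.of_isClosed_subset (isClosed_coverBody E g) (coverBody_subset_Icc E g)

/-- If `E` has a cover with fewer than `g` vertices, then `coverBody E g` contains a cube of side
`1 / (12 * (n + 1))`. -/
theorem le_volume_coverBody (A B : Finset (Fin n)) (hAB : ∀ e ∈ E, e.1 ∈ A ∨ e.2 ∈ B)
    (hg : A.card + B.card < g) :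
    (1 / (12 * ((n : ℝ) + 1))) ^ (2 * n) ≤ volume.real (coverBody E g) := by
  classical
  set δ : ℝ := 1 / (6 * ((n : ℝ) + 1)) with hδ
  have hn : (0 : ℝ) ≤ n := Nat.cast_nonneg n
  have hδ0 : 0 < δ := by positivity
  have hδn : δ * (6 * (n + 1)) = 1 := by rw [hδ]; field_simp
  have hδ1 : δ ≤ 1 := by nlinarith
  -- the cover as a `0`-`1` vector
  set z : Vert n → ℝ := Sum.elim (fun u => if u ∈ A then 1 else 0) (fun v => if v ∈ B then 1 else 0)
    with hz
  have hz0 : ∀ v, 0 ≤ z v := by rintro (v | v) <;> simp only [hz, Sum.elim_inl, Sum.elim_inr] <;>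
    split_ifs <;> norm_num
  have hz1 : ∀ v, z v ≤ 1 := by rintro (v | v) <;> simp only [hz, Sum.elim_inl, Sum.elim_inr] <;>
    split_ifs <;> norm_num
  have hzs : ∑ v, z v = A.card + B.card := by
    simp [hz, Fintype.sum_sum_type]
  have hzE : ∀ e ∈ E, 1 ≤ z (Sum.inl e.1) + z (Sum.inr e.2) := by
    intro e he
    rcases hAB e he with h | h
    · have h1 : z (Sum.inl e.1) = 1 := by simp [hz, h]
      linarith [hz0 (Sum.inr e.2)]
    · have h1 : z (Sum.inr e.2) = 1 := by simp [hz, h]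
      linarith [hz0 (Sum.inl e.1)]
  have hsub : Icc (fun v => (1 - δ) * z v + δ / 2) (fun v => (1 - δ) * z v + δ) ⊆
      coverBody E g := by
    rintro x ⟨hx1, hx2⟩
    have hx1 : ∀ v, (1 - δ) * z v + δ / 2 ≤ x v := hx1
    have hx2 : ∀ v, x v ≤ (1 - δ) * z v + δ := hx2
    refine ⟨fun v => ⟨?_, ?_⟩, fun e he => ?_, ?_⟩
    · have := mul_nonneg (sub_nonneg.2 hδ1) (hz0 v)
      linarith [hx1 v]
    · have := mul_le_mul_of_nonneg_left (hz1 v) (sub_nonneg.2 hδ1)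
      linarith [hx2 v]
    · have := mul_le_mul_of_nonneg_left (hzE e he) (sub_nonneg.2 hδ1)
      linarith [hx1 (Sum.inl e.1), hx1 (Sum.inr e.2)]
    · have h1 : ∑ v, x v ≤ ∑ v : Vert n, ((1 - δ) * z v + δ) := Finset.sum_le_sum fun v _ => hx2 v
      rw [Finset.sum_add_distrib, ← Finset.mul_sum, hzs, Finset.sum_const, Finset.card_univ,
        Fintype.card_sum, Fintype.card_fin, nsmul_eq_mul] at h1
      push_cast at h1
      have h2 : (A.card : ℝ) + B.card + 1 ≤ g := by exact_mod_cast hg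
      have h3 : (0 : ℝ) ≤ A.card + B.card := by positivity
      nlinarith
  have hvol : volume.real (Icc (fun v => (1 - δ) * z v + δ / 2) (fun v => (1 - δ) * z v + δ)) =
      (1 / (12 * ((n : ℝ) + 1))) ^ (2 * n) := by
    rw [measureReal_def, Real.volume_Icc_pi_toReal (fun v => by simp only; linarith)]
    have h1 : ∀ v : Vert n, (1 - δ) * z v + δ - ((1 - δ) * z v + δ / 2) =
        1 / (12 * ((n : ℝ) + 1)) := by
      intro v; rw [hδ]; field_simp; ring
    simp only [h1, Finset.prod_const, Finset.card_univ, Fintype.card_sum, Fintype.card_fin]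
    rw [two_mul]
  rw [← hvol]
  exact measureReal_mono hsub (volume_coverBody_ne_top E g)

/-- The centre of gravity of `coverBody E g`. -/
noncomputable def bodyCentroid : Vert n → ℝ := ⨍ x in coverBody E g, x

variable {E g}

theorem bodyCentroid_mem (h : 0 < volume.real (coverBody E g)) :
    bodyCentroid E g ∈ coverBody E g := by
  refine (convex_coverBody E g).set_average_mem (isClosed_coverBody E g) ?_
    (volume_coverBody_ne_top E g) ?_ ?_
  · intro h0
    simp [measureReal_def, h0] at h
  · exact ae_restrict_mem (isClosed_coverBody E g).measurableSet
  · exact continuousOn_id.integrableOn_compact (isCompact_coverBody E g)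

/-- Adding an edge violated by the centroid cuts off a quarter of the volume. -/
theorem volume_coverBody_insert_le (e : Pair n)
    (he : bodyCentroid E g (Sum.inl e.1) + bodyCentroid E g (Sum.inr e.2) < 1) :
    volume.real (coverBody (insert e E) g) ≤ 3 / 4 * volume.real (coverBody E g) := by
  rcases measureReal_nonneg (μ := volume) (s := coverBody E g) |>.eq_or_lt with h0 | h0
  · rw [← h0, mul_zero, h0]
    exact measureReal_mono (coverBody_mono (Finset.subset_insert _ _) le_rfl)
      (volume_coverBody_ne_top E g)
  have hint : IntegrableOn (fun x : Vert n → ℝ => x) (coverBody E g) :=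
    continuousOn_id.integrableOn_compact (isCompact_coverBody E g)
  have hcoord : ∀ v, ∫ x in coverBody E g, x v =
      volume.real (coverBody E g) * bodyCentroid E g v := by
    intro v
    have h1 := (ContinuousLinearMap.proj (R := ℝ) (φ := fun _ : Vert n => ℝ) v).integral_comp_comm
      hint
    simp only [ContinuousLinearMap.proj_apply] at h1
    rw [h1, bodyCentroid, setAverage_eq]
    simp only [Pi.smul_apply, smul_eq_mul]
    rw [← mul_assoc, mul_inv_cancel₀ h0.ne', one_mul]
  have hintc : ∀ v, IntegrableOn (fun x : Vert n → ℝ => x v) (coverBody E g) := fun v =>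
    (continuous_apply v).continuousOn.integrableOn_compact (isCompact_coverBody E g)
  have hcut := volume_inter_nonneg_le (convex_coverBody E g)
    (isClosed_coverBody E g).measurableSet (volume_coverBody_ne_top E g)
    (Z := fun x => x (Sum.inl e.1) + x (Sum.inr e.2) - 1) (by fun_prop)
    (by intro x y; simp only [Pi.smul_apply, Pi.add_apply, smul_eq_mul]; ring) (B := 1) (by
      intro x hx
      have h1 := hx.1 (Sum.inl e.1)
      have h2 := hx.1 (Sum.inr e.2)
      rw [abs_le]
      constructor <;> linarith [h1.1, h1.2, h2.1, h2.2]) (by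
      rw [integral_sub (f := fun x : Vert n → ℝ => x (Sum.inl e.1) + x (Sum.inr e.2))
        ((hintc _).add (hintc _)) (integrableOn_const (volume_coverBody_ne_top E g)),
        integral_add (hintc _) (hintc _), hcoord, hcoord, setIntegral_const, smul_eq_mul]
      nlinarith)
  refine (measureReal_mono ?_ (measure_ne_top_of_subset inter_subset_left
    (volume_coverBody_ne_top E g))).trans hcut
  intro x hx
  refine ⟨coverBody_mono (Finset.subset_insert _ _) le_rfl hx, ?_⟩
  have := hx.2.1 e (Finset.mem_insert_self _ _)
  change (0 : ℝ) ≤ _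
  linarith

end coverBody

/-! ### Combining decision trees -/

variable {n : ℕ} {α β : Type}

/-- Run `A`, and continue with the algorithm that its output selects. -/
def Algorithm.bind : Algorithm n α → (α → Algorithm n β) → Algorithm n β
  | .output a, k => k a
  | .query S yes no, k => .query S (yes.bind k) (no.bind k)

theorem Algorithm.result_bind (G : SimpleGraph (Vert n)) (A : Algorithm n α)
    (k : α → Algorithm n β) : (A.bind k).result G = (k (A.result G)).result G := by
  induction A with
  | output a => rfl
  | query S yes no ih1 ih2 =>
    simp only [Algorithm.bind, Algorithm.result, ih1, ih2]
    split_ifs <;> rfl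

theorem Algorithm.queries_bind (G : SimpleGraph (Vert n)) (A : Algorithm n α)
    (k : α → Algorithm n β) :
    (A.bind k).queries G = A.queries G + (k (A.result G)).queries G := by
  induction A with
  | output a => simp [Algorithm.bind, Algorithm.queries, Algorithm.result]
  | query S yes no ih1 ih2 =>
    simp only [Algorithm.bind, Algorithm.queries, Algorithm.result, ih1, ih2]
    split_ifs <;> ring

/-- Half of the elements of a finite set, rounded down. -/
noncomputable def halfSubset (S : Finset (Pair n)) : Finset (Pair n) :=
  (Finset.exists_subset_card_eq (Nat.div_le_self S.card 2)).choose

theorem halfSubset_subset (S : Finset (Pair n)) : halfSubset S ⊆ S :=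
  (Finset.exists_subset_card_eq (Nat.div_le_self S.card 2)).choose_spec.1

theorem card_halfSubset (S : Finset (Pair n)) : (halfSubset S).card = S.card / 2 :=
  (Finset.exists_subset_card_eq (Nat.div_le_self S.card 2)).choose_spec.2

/-- Binary search with `m` queries for an edge in `S`. The output is a set of pairs, which is a
single edge if `S` contains an edge and has at most `2 ^ m` elements. -/
noncomputable def search : ℕ → Finset (Pair n) → Algorithm n (Finset (Pair n))
  | 0, S => .output S
  | m + 1, S => .query (halfSubset S) (search m (halfSubset S)) (search m (S \ halfSubset S))

theorem queries_search (G : SimpleGraph (Vert n)) (m : ℕ) (S : Finset (Pair n)) :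
    (search m S).queries G = m := by
  induction m generalizing S with
  | zero => rfl
  | succ m ih => simp [search, Algorithm.queries, ih, add_comm]

theorem result_search (G : SimpleGraph (Vert n)) (m : ℕ) (S : Finset (Pair n))
    (hS : OrAnswer G S) (hm : S.card ≤ 2 ^ m) :
    ∃ e ∈ S, IsEdge G e ∧ (search m S).result G = {e} := by
  induction m generalizing S with
  | zero =>
    obtain ⟨e, he, heG⟩ := hS
    refine ⟨e, he, heG, ?_⟩
    exact Finset.eq_singleton_iff_unique_mem.2
      ⟨he, fun f hf => Finset.card_le_one.1 hm f hf e he⟩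
  | succ m ih =>
    have hc := card_halfSubset S
    simp only [search, Algorithm.result]
    split_ifs with h
    · obtain ⟨e, he, h1⟩ := ih _ h (by omega)
      exact ⟨e, halfSubset_subset S he, h1⟩
    · have h' : OrAnswer G (S \ halfSubset S) := by
        obtain ⟨e, he, heG⟩ := hS
        exact ⟨e, Finset.mem_sdiff.2 ⟨he, fun h2 => h ⟨e, h2, heG⟩⟩, heG⟩
      obtain ⟨e, he, h1⟩ := ih _ h' (by
        rw [Finset.card_sdiff_of_subset (halfSubset_subset S)]
        omega)
      exact ⟨e, (Finset.mem_sdiff.1 he).1, h1⟩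

/-! ### The cutting-plane algorithm -/

/-- A matching of size `g` inside `E`, if there is one. -/
noncomputable def chosenMatching (E : Finset (Pair n)) (g : ℕ) : Finset (Pair n) :=
  Classical.epsilon fun M => M ⊆ E ∧
    (∀ e ∈ M, ∀ f ∈ M, e ≠ f → e.1 ≠ f.1 ∧ e.2 ≠ f.2) ∧ M.card = g

/-- A body of small volume forces a matching of size `g`: otherwise König's theorem gives a cover
with fewer than `g` vertices, which has a cube of covers around it. -/
theorem chosenMatching_spec {E : Finset (Pair n)} {g : ℕ}
    (h : volume.real (coverBody E g) < (1 / (12 * ((n : ℝ) + 1))) ^ (2 * n)) :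
    chosenMatching E g ⊆ E ∧ (∀ e ∈ chosenMatching E g, ∀ f ∈ chosenMatching E g,
      e ≠ f → e.1 ≠ f.1 ∧ e.2 ≠ f.2) ∧ (chosenMatching E g).card = g := by
  refine Classical.epsilon_spec (p := fun M => M ⊆ E ∧
    (∀ e ∈ M, ∀ f ∈ M, e ≠ f → e.1 ≠ f.1 ∧ e.2 ≠ f.2) ∧ M.card = g) ?_
  refine exists_matching_of_le_cover E g fun A B hAB => ?_
  by_contra! hlt
  exact absurd (le_volume_coverBody E g A B hAB hlt) (not_le.2 h)

open Classical in
/-- The pairs at which `c` violates the covering constraint. -/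
noncomputable def violated (c : Vert n → ℝ) : Finset (Pair n) :=
  Finset.univ.filter fun e => c (Sum.inl e.1) + c (Sum.inr e.2) < 1

theorem mem_violated {c : Vert n → ℝ} {e : Pair n} :
    e ∈ violated c ↔ c (Sum.inl e.1) + c (Sum.inr e.2) < 1 := by
  simp [violated]

open Classical in
/-- The cutting-plane algorithm with at most `k` rounds. Its state consists of the edges `E` found
so far, a target `g` and a fractional vertex cover `y` of size at most `g + 1 / 3`. A round queries
the pairs violated by the centroid of `coverBody E g`: an edge found among them is added to `E`, and
if there is none, then the centroid replaces `y` and the target decreases. -/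
noncomputable def cuttingPlane (m : ℕ) : ℕ → Finset (Pair n) → ℕ → (Vert n → ℝ) →
    Algorithm n (Finset (Pair n) × (Vert n → ℝ))
  | 0, E, g, y => .output (chosenMatching E g, y)
  | k + 1, E, g, y =>
    if volume.real (coverBody E g) < (1 / (12 * ((n : ℝ) + 1))) ^ (2 * n) then
      .output (chosenMatching E g, y)
    else
      .query (violated (bodyCentroid E g))
        ((search m (violated (bodyCentroid E g))).bind fun S => cuttingPlane m k (S ∪ E) g y)
        (cuttingPlane m k E (g - 1) (bodyCentroid E g))

theorem queries_cuttingPlane_le (G : SimpleGraph (Vert n)) (m k : ℕ) (E : Finset (Pair n)) (g : ℕ)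
    (y : Vert n → ℝ) : (cuttingPlane m k E g y).queries G ≤ k * (1 + m) := by
  induction k generalizing E g y with
  | zero => simp [cuttingPlane, Algorithm.queries]
  | succ k ih =>
    rw [cuttingPlane]
    split_ifs with h
    · simp [Algorithm.queries]
    · simp only [Algorithm.queries]
      split_ifs
      · rw [Algorithm.queries_bind, queries_search]
        linarith [ih ((search m (violated (bodyCentroid E g))).result G ∪ E) g y]
      · linarith [ih E (g - 1) (bodyCentroid E g)]

theorem isFractionalVertexCover_of_pairs {G : SimpleGraph (Vert n)} (hG : Bip G) {x : Vert n → ℝ}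
    (hx : ∀ v, 0 ≤ x v ∧ x v ≤ 1)
    (h : ∀ e : Pair n, IsEdge G e → 1 ≤ x (Sum.inl e.1) + x (Sum.inr e.2)) :
    IsFractionalVertexCover G x := by
  refine ⟨hx, fun u v huv => ?_⟩
  rcases hG.mem_of_adj huv with ⟨⟨a, rfl⟩, ⟨b, rfl⟩⟩ | ⟨⟨a, rfl⟩, ⟨b, rfl⟩⟩
  · exact h (a, b) huv
  · rw [add_comm]; exact h (b, a) huv.symm

/-- Correctness of the algorithm. Here `j` counts the cuts made so far, each of which has cost the
body at least a quarter of its volume, and every other round has decreased the target `g`. -/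
theorem cuttingPlane_spec {G : SimpleGraph (Vert n)} (hG : Bip G) {m T : ℕ}
    (hm : n * n ≤ 2 ^ m) (hT : (3 / 4 : ℝ) ^ T < (1 / (12 * ((n : ℝ) + 1))) ^ (2 * n))
    (k j : ℕ) (E : Finset (Pair n)) (g : ℕ) (y : Vert n → ℝ) (hjk : j + k = T + g)
    (hvol : volume.real (coverBody E g) ≤ (3 / 4) ^ j) (hE : ∀ e ∈ E, IsEdge G e)
    (hy : IsFractionalVertexCover G y) (hyg : ∑ v, y v ≤ g + 1 / 3) :
    IsMatching G ((cuttingPlane m k E g y).result G).1 ∧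
      IsFractionalVertexCover G ((cuttingPlane m k E g y).result G).2 ∧
      ∑ v, ((cuttingPlane m k E g y).result G).2 v ≤
        ((cuttingPlane m k E g y).result G).1.card + 1 / 3 := by
  have output_spec : ∀ {E : Finset (Pair n)} {g : ℕ} {y : Vert n → ℝ},
      volume.real (coverBody E g) < (1 / (12 * ((n : ℝ) + 1))) ^ (2 * n) →
      (∀ e ∈ E, IsEdge G e) → IsFractionalVertexCover G y → ∑ v, y v ≤ g + 1 / 3 →
      IsMatching G (chosenMatching E g) ∧ IsFractionalVertexCover G y ∧
        ∑ v, y v ≤ (chosenMatching E g).card + 1 / 3 := by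
    intro E g y hv hE hy hyg
    obtain ⟨h1, h2, h3⟩ := chosenMatching_spec hv
    exact ⟨⟨fun e he => hE e (h1 he), h2⟩, hy, by rwa [h3]⟩
  induction k generalizing j E g y with
  | zero =>
    refine output_spec (hvol.trans_lt (lt_of_le_of_lt ?_ hT)) hE hy hyg
    exact pow_le_pow_of_le_one (by norm_num) (by norm_num) (by omega)
  | succ k ih =>
    rw [cuttingPlane]
    split_ifs with hv
    · exact output_spec hv hE hy hyg
    push Not at hv
    have hmem := bodyCentroid_mem (lt_of_lt_of_le (by positivity) hv)
    set c := bodyCentroid E g with hc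
    simp only [Algorithm.result]
    split_ifs with hq
    · obtain ⟨e, heS, heG, hres⟩ := result_search G m (violated c) hq (by
        refine (Finset.card_le_univ _).trans ?_
        simpa using hm)
      rw [Algorithm.result_bind, hres]
      refine ih (j + 1) _ g y (by omega) ?_ ?_ hy hyg
      · rw [← Finset.insert_eq, pow_succ]
        have := volume_coverBody_insert_le (E := E) (g := g) e (mem_violated.1 heS)
        linarith
      · intro f hf
        rcases Finset.mem_union.1 hf with hf | hf
        · rw [Finset.mem_singleton.1 hf]; exact heG
        · exact hE f hf
    · have hg : 1 ≤ g := by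
        have h1 : 0 ≤ ∑ v, c v := Finset.sum_nonneg fun v _ => (hmem.1 v).1
        have h2 : (0 : ℝ) < g := by linarith [hmem.2.2]
        exact_mod_cast h2
      -- the size of `c` is at most `g - 2 / 3 = (g - 1) + 1 / 3`
      refine ih j E (g - 1) c (by omega) ?_ hE ?_ ?_
      · exact (measureReal_mono (coverBody_mono le_rfl (Nat.sub_le _ _))
          (volume_coverBody_ne_top E g)).trans hvol
      · refine isFractionalVertexCover_of_pairs hG hmem.1 fun e he => ?_
        by_contra! hlt
        exact hq ⟨e, mem_violated.2 hlt, he⟩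
      · push_cast [hg]
        linarith [hmem.2.2]

/-- The number of cuts after which the volume is certainly too small for `n` vertices per side. -/
def maxCuts (n : ℕ) : ℕ := 6 * n * (Nat.clog 2 n + 5) + 1

theorem pow_maxCuts_lt (n : ℕ) :
    (3 / 4 : ℝ) ^ maxCuts n < (1 / (12 * ((n : ℝ) + 1))) ^ (2 * n) := by
  -- three cuts halve the volume, and `12 * (n + 1) ≤ 2 ^ (clog 2 n + 5)`
  have h1 : (3 / 4 : ℝ) ^ maxCuts n < (3 / 4) ^ (3 * ((Nat.clog 2 n + 5) * (2 * n))) :=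
    pow_lt_pow_right_of_lt_one₀ (by norm_num) (by norm_num) (by
      rw [maxCuts, Nat.lt_succ_iff]; apply le_of_eq; ring)
  refine h1.trans_le ?_
  rcases Nat.eq_zero_or_pos n with rfl | hn
  · simp
  rw [pow_mul, pow_mul]
  refine pow_le_pow_left₀ (by positivity) ?_ _
  calc ((3 / 4 : ℝ) ^ 3) ^ (Nat.clog 2 n + 5) ≤ (1 / 2) ^ (Nat.clog 2 n + 5) :=
        pow_le_pow_left₀ (by norm_num) (by norm_num) _
    _ = 1 / (2 ^ Nat.clog 2 n * 32) := by rw [one_div_pow, pow_add]; norm_num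
    _ ≤ 1 / (12 * ((n : ℝ) + 1)) := by
        apply one_div_le_one_div_of_le (by positivity)
        have h2 : (n : ℝ) ≤ 2 ^ Nat.clog 2 n := by exact_mod_cast Nat.le_pow_clog one_lt_two n
        have h3 : (1 : ℝ) ≤ n := by exact_mod_cast hn
        linarith

/-- The cutting-plane algorithm started with no edges and the cover of size `n` by the left side. -/
noncomputable def matchingAlgorithm (n : ℕ) : Algorithm n (Finset (Pair n) × (Vert n → ℝ)) :=
  cuttingPlane (2 * Nat.clog 2 n) (maxCuts n + n) ∅ n (Sum.elim (fun _ => 1) fun _ => 0)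

theorem matchingAlgorithm_spec {G : SimpleGraph (Vert n)} (hG : Bip G) :
    IsMatching G ((matchingAlgorithm n).result G).1 ∧
      IsFractionalVertexCover G ((matchingAlgorithm n).result G).2 ∧
      ∑ v, ((matchingAlgorithm n).result G).2 v ≤
        ((matchingAlgorithm n).result G).1.card + 1 / 3 := by
  refine cuttingPlane_spec hG ?_ (pow_maxCuts_lt n) _ 0 _ _ _ (by omega) ?_ (by simp) ?_ ?_
  · rw [two_mul, pow_add]
    exact Nat.mul_le_mul (Nat.le_pow_clog one_lt_two n) (Nat.le_pow_clog one_lt_two n)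
  · simpa [measureReal_def] using
      ENNReal.toReal_mono ENNReal.one_ne_top (volume_coverBody_le_one (n := n) ∅ n)
  · refine isFractionalVertexCover_of_pairs hG ?_ fun e _ => by simp
    rintro (v | v) <;> simp
  · simp [Fintype.sum_sum_type]

theorem queries_matchingAlgorithm_le (hn : 2 ≤ n) (G : SimpleGraph (Vert n)) :
    ((matchingAlgorithm n).queries G : ℝ) ≤ 1026 * ((n : ℝ) * Real.log n ^ 2) := by
  have h1 := queries_cuttingPlane_le G (2 * Nat.clog 2 n) (maxCuts n + n) ∅ n
    (Sum.elim (fun _ => 1) fun _ => 0)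
  set L := Nat.clog 2 n with hL
  have hL1 : 1 ≤ L := Nat.clog_pos one_lt_two hn
  have hlog2 : (0.69 : ℝ) < Real.log 2 := by linarith [Real.log_two_gt_d9]
  have hLlog : (L : ℝ) ≤ 3 * Real.log n := by
    have hlt : 2 ^ (L - 1) < n := Nat.pow_pred_clog_lt_self one_lt_two hn
    have h2 : ((L - 1 : ℕ) : ℝ) * Real.log 2 ≤ Real.log n := by
      rw [← Real.log_pow]
      exact Real.log_le_log (by positivity) (by exact_mod_cast hlt.le)
    have h3 : Real.log 2 ≤ Real.log n := Real.log_le_log two_pos (by exact_mod_cast hn)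
    push_cast [hL1] at h2
    have h4 : (1 : ℝ) ≤ L := by exact_mod_cast hL1
    nlinarith
  have h2 : (maxCuts n + n) * (1 + 2 * L) ≤ 114 * (n * L ^ 2) := by
    have h3 : maxCuts n + n ≤ 38 * (n * L) := by
      rw [maxCuts, ← hL]
      nlinarith [Nat.mul_le_mul_left n hL1]
    calc (maxCuts n + n) * (1 + 2 * L) ≤ 38 * (n * L) * (3 * L) :=
          Nat.mul_le_mul h3 (by omega)
      _ = 114 * (n * L ^ 2) := by ring
  have h3 : ((matchingAlgorithm n).queries G : ℝ) ≤ 114 * (n * (L : ℝ) ^ 2) := by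
    exact_mod_cast h1.trans h2
  have h4 : (L : ℝ) ^ 2 ≤ (3 * Real.log n) ^ 2 := pow_le_pow_left₀ (Nat.cast_nonneg _) hLlog 2
  calc ((matchingAlgorithm n).queries G : ℝ) ≤ 114 * (n * (L : ℝ) ^ 2) := h3
    _ ≤ 114 * (n * (3 * Real.log n) ^ 2) := by gcongr
    _ = _ := by ring

/-! ### The two versions of the matching problem -/

/-- Weak duality: a matching has at most as many edges as a fractional vertex cover has weight. -/
theorem card_le_sum_of_isMatching {G : SimpleGraph (Vert n)} {M : Finset (Pair n)}
    (hM : IsMatching G M) {x : Vert n → ℝ} (hx : IsFractionalVertexCover G x) :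
    (M.card : ℝ) ≤ ∑ v, x v := by
  have hl : ∑ e ∈ M, x (Sum.inl e.1) ≤ ∑ u, x (Sum.inl u) := by
    rw [← Finset.sum_image (f := fun u => x (Sum.inl u)) (g := Prod.fst) (s := M)]
    · exact Finset.sum_le_univ_sum_of_nonneg fun u => (hx.1 _).1
    · intro e he f hf hef
      by_contra hne
      exact (hM.2 e he f hf hne).1 hef
  have hr : ∑ e ∈ M, x (Sum.inr e.2) ≤ ∑ v, x (Sum.inr v) := by
    rw [← Finset.sum_image (f := fun v => x (Sum.inr v)) (g := Prod.snd) (s := M)]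
    · exact Finset.sum_le_univ_sum_of_nonneg fun u => (hx.1 _).1
    · intro e he f hf hef
      by_contra hne
      exact (hM.2 e he f hf hne).2 hef
  calc (M.card : ℝ) = ∑ e ∈ M, (1 : ℝ) := by simp
    _ ≤ ∑ e ∈ M, (x (Sum.inl e.1) + x (Sum.inr e.2)) :=
        Finset.sum_le_sum fun e he => hx.2 _ _ (hM.1 e he)
    _ ≤ ∑ v, x v := by rw [Finset.sum_add_distrib, Fintype.sum_sum_type]; linarith

/-- The answer to the decision version for `F`, from a matching `p.1` and a fractional vertex cover
`p.2` of size at most `p.1.card + 1 / 3`. -/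
noncomputable def thresholdAnswer (F : ℤ) (p : Finset (Pair n) × (Vert n → ℝ)) :
    (Vert n → ℝ) ⊕ Finset (Pair n) :=
  if h : F + 1 ≤ p.1.card then
    Sum.inr (Finset.exists_subset_card_eq (Int.toNat_le.2 h)).choose
  else Sum.inl p.2

theorem thresholdAnswer_spec {G : SimpleGraph (Vert n)} {F : ℤ} (hF : -1 ≤ F)
    {p : Finset (Pair n) × (Vert n → ℝ)} (hM : IsMatching G p.1)
    (hx : IsFractionalVertexCover G p.2) (hp : ∑ v, p.2 v ≤ p.1.card + 1 / 3) :
    (∃ x, thresholdAnswer F p = Sum.inl x ∧ x ∈ coverPolytope G F) ∨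
      ∃ M, thresholdAnswer F p = Sum.inr M ∧ IsMatching G M ∧ (M.card : ℤ) = F + 1 ∧
        coverPolytope G F = ∅ := by
  by_cases h : F + 1 ≤ p.1.card
  · right
    obtain ⟨h1, h2⟩ := (Finset.exists_subset_card_eq (Int.toNat_le.2 h)).choose_spec
    refine ⟨_, dif_pos h, ?_⟩
    set M := (Finset.exists_subset_card_eq (Int.toNat_le.2 h)).choose
    have hM' : IsMatching G M :=
      ⟨fun e he => hM.1 e (h1 he), fun e he f hf => hM.2 e (h1 he) f (h1 hf)⟩
    have hcard : (M.card : ℤ) = F + 1 := by rw [h2]; omega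
    refine ⟨hM', hcard, eq_empty_of_forall_notMem ?_⟩
    rintro x ⟨hx1, hx2⟩
    have h3 := card_le_sum_of_isMatching hM' hx2
    have h4 : (M.card : ℝ) = F + 1 := by exact_mod_cast hcard
    linarith
  · left
    refine ⟨_, dif_neg h, ?_, hx⟩
    have h3 : (p.1.card : ℤ) ≤ F := by omega
    have h4 : (p.1.card : ℝ) ≤ F := by exact_mod_cast h3
    linarith

end ORQuery

theorem mainTheorem5 :
    -- finding a maximum matching and a certificate of its optimality
    (∃ A : (n : ℕ) → ORQuery.Algorithm n (Finset (ORQuery.Pair n) × (ORQuery.Vert n → ℝ)),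
      (∃ C : ℝ, ∀ n : ℕ, 2 ≤ n → ∀ G : SimpleGraph (ORQuery.Vert n), ORQuery.Bip G →
        (((A n).queries G : ℕ) : ℝ) ≤ C * ((n : ℝ) * Real.log (n : ℝ) ^ 2)) ∧
      ∀ (n : ℕ) (G : SimpleGraph (ORQuery.Vert n)), ORQuery.Bip G →
        ORQuery.IsMaximumMatching G ((A n).result G).1 ∧
        ORQuery.IsFractionalVertexCover G ((A n).result G).2 ∧
        ∑ v, ((A n).result G).2 v < (((A n).result G).1.card : ℝ) + 1) ∧
    -- the decision version, for a given integer `F`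
    (∃ A : (n : ℕ) → ℤ →
        ORQuery.Algorithm n ((ORQuery.Vert n → ℝ) ⊕ Finset (ORQuery.Pair n)),
      (∃ C : ℝ, ∀ n : ℕ, 2 ≤ n → ∀ F : ℤ, -1 ≤ F →
        ∀ G : SimpleGraph (ORQuery.Vert n), ORQuery.Bip G →
          (((A n F).queries G : ℕ) : ℝ) ≤ C * ((n : ℝ) * Real.log (n : ℝ) ^ 2)) ∧
      ∀ (n : ℕ) (F : ℤ), -1 ≤ F → ∀ G : SimpleGraph (ORQuery.Vert n), ORQuery.Bip G →
        (∃ x : ORQuery.Vert n → ℝ, (A n F).result G = Sum.inl x ∧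
          x ∈ ORQuery.coverPolytope G F) ∨
        (∃ M : Finset (ORQuery.Pair n), (A n F).result G = Sum.inr M ∧
          ORQuery.IsMatching G M ∧ (M.card : ℤ) = F + 1 ∧
          ORQuery.coverPolytope G F = ∅)) := by
  refine ⟨⟨ORQuery.matchingAlgorithm, ⟨1026, fun n hn G _ =>
    ORQuery.queries_matchingAlgorithm_le hn G⟩, fun n G hG => ?_⟩,
    ⟨fun n F => (ORQuery.matchingAlgorithm n).bind fun p => .output (ORQuery.thresholdAnswer F p),
      ⟨1026, fun n hn F _ G _ => ?_⟩, fun n F hF G hG => ?_⟩⟩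
  · obtain ⟨hM, hx, hle⟩ := ORQuery.matchingAlgorithm_spec hG
    refine ⟨⟨hM, fun M' hM' => ?_⟩, hx, by linarith⟩
    have h1 := ORQuery.card_le_sum_of_isMatching hM' hx
    rw [← Nat.lt_succ_iff, ← Nat.cast_lt (α := ℝ)]
    push_cast
    linarith
  · rw [ORQuery.Algorithm.queries_bind]
    exact ORQuery.queries_matchingAlgorithm_le hn G
  · obtain ⟨hM, hx, hle⟩ := ORQuery.matchingAlgorithm_spec hG
    rw [ORQuery.Algorithm.result_bind]
    exact ORQuery.thresholdAnswer_spec hF hM hx hle
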